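/- Let $\Gamma\subset\mathrm{SL}(2,\mathbb R)$ be a discrete subgroup with $-1\in\Gamma$ such that the hyperbolic surface $\mathcal Y=\Gamma\backslash\mathbb H$ has finite area, and let $\mathcal X=\Gamma\backslash\mathrm{SL}(2,\mathbb R)$ be its unit tangent bundle. Let $\mu$ be the Liouville measure on $\mathcal X$ normalised by $\mu(\mathcal X)=1$, that is, the projection to $\mathcal X$ of Haar measure on a fundamental domain of $\Gamma$ in $\mathrm{SL}(2,\mathbb R)$, the fundamental domain having mass one. For $x=\Gamma g\in\mathcal X$, define the geodesic flow and the unstable and stable horocycle flows by $$\varphi_t(x)=x\begin{pmatrix}e^{t/2}&0\\0&e^{-t/2}\end{pmatrix},\qquad h^+_s(x)=x\begin{pmatrix}1&0\\-s&1\end{pmatrix},\qquad h^-_s(x)=x\begin{pmatrix}1&s\\0&1\end{pmatrix}.$$ Let $K$ be the number of cusps of $\mathcal Y$. For $\kappa\in[K]=\{1,\dots,K\}$ let $\mathcal C_\kappa\subset\mathcal X$ be the closed stable horocycle of length one around the $\kappa$th cusp (its unit tangent vectors point towards the cusp, and its points have minimal period one under $h^-$), and fix $x_\kappa\in\mathcal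 C_\kappa$. For $\boldsymbol\sigma=(\sigma_1,\dots,\sigma_K)\in\mathbb R^K$ and $R\in\mathbb R$ put $$\mathcal H(\boldsymbol\sigma,R)=\bigcup_{\kappa=1}^K\{\varphi_t(y): y\in\mathcal C_\kappa,\ t\ge\sigma_\kappa+R\},\qquad \Sigma^K(\boldsymbol\sigma)=\{(s,t,\kappa): s\in[0,1),\ t\ge\sigma_\kappa,\ \kappa\in[K]\},$$ and parametrise $\mathcal H(\boldsymbol\sigma,R)$ by $\iota_{\boldsymbol\sigma,R}:\Sigma^K(\boldsymbol\sigma)\to\mathcal X$, $(s,t,\kappa)\mapsto\varphi_{t+R}\circ h^-_s(x_\kappa)$. For $x_0\in\mathcal X$ and $j=1,2,\dots$ let $\xi_j(x_0,\boldsymbol\sigma,R)\in(0,\infty]$ be the $j$th time $r>0$ at which $h^+_r(x_0)\in\mathcal H(\boldsymbol\sigma,R)$ (with $\xi_j=\infty$ if there are fewer than $j$ such times), and, if $\xi_j<\infty$, let $(w_j,\kappa_j)=(w_j(x_0,\boldsymbol\sigma,R),\kappa_j(x_0,\boldsymbol\sigma,R))\in\Sigma^K(\boldsymbol\sigma)$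 be the impact parameter and cusp label of the $j$th hit, defined by $\iota_{\boldsymbol\sigma,R}(w_j,\kappa_j)=h^+_{\xi_j}(x_0)$. A Borel probability measure $\lambda$ on $\mathcal X$ is called admissible if $\lim_{t\to\infty}\lambda(\varphi_t\mathcal E)=\mu(\mathcal E)$ for every Borel set $\mathcal E\subset\mathcal X$ with $\mu(\partial\mathcal E)=0$. **Theorem.** Assume that $\lambda$ is admissible, and fix $\boldsymbol\sigma\in\mathbb R^K$. Then, for $N\in\mathbb N$, $k_1,\dots,k_N\in\mathbb Z_{\ge0}$, $0<T_1\le\dots\le T_N$, and Borel sets $\mathcal D_1,\dots,\mathcal D_N\subset\Sigma^K(\boldsymbol\sigma)$ with boundary of Lebesgue measure zero, $$\lim_{R\to\infty}\lambda\bigl\{x_0\in\mathcal X:\ \#\{j: e^{-R}\xi_j(x_0,\boldsymbol\sigma,R)\le T_i,\ (w_j(x_0,\boldsymbol\sigma,R),\kappa_j(x_0,\boldsymbol\sigma,R))\in\mathcal D_i\}=k_i\ \ \forall i\le N\bigr\}$$ $$=\mu\bigl\{x\in\mathcal X:\ \#\{j: \xi_j(x,\boldsymbol\sigma,0)\le T_i,\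 (w_j(x,\boldsymbol\sigma,0),\kappa_j(x,\boldsymbol\sigma,0))\in\mathcal D_i\}=k_i\ \ \forall i\le N\bigr\}.$$ -/

import Mathlib

open Set Filter Topology MeasureTheory

namespace HorocycleFlow

noncomputable section

/-- The group `SL(2, ℝ)`, with its usual topology and its Borel σ-algebra. -/
abbrev SL2R : Type := Matrix.SpecialLinearGroup (Fin 2) ℝ

instance instMeasurableSpaceSL2R : MeasurableSpace SL2R := borel SL2R

instance instBorelSpaceSL2R : BorelSpace SL2R := ⟨rfl⟩

/-- The diagonal matrix with entries `exp (t / 2)`, `exp (-t / 2)`. -/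
def geodesicMatrix (t : ℝ) : SL2R :=
  ⟨!![Real.exp (t / 2), 0; 0, Real.exp (-t / 2)], by
    rw [Matrix.det_fin_two_of, ← Real.exp_add]
    ring_nf
    simp⟩

/-- The lower triangular unipotent matrix with lower left entry `-s`. -/
def unstableMatrix (s : ℝ) : SL2R :=
  ⟨!![1, 0; -s, 1], by simp [Matrix.det_fin_two_of]⟩

/-- The upper triangular unipotent matrix with upper right entry `s`. -/
def stableMatrix (s : ℝ) : SL2R :=
  ⟨!![1, s; 0, 1], by simp [Matrix.det_fin_two_of]⟩

/-- The space `𝒳 = Γ \ SL(2, ℝ)` of cosets `Γ g`. If `Γ` is discrete and contains `-1`, this is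
the unit tangent bundle of the hyperbolic surface `𝒴 = Γ \ ℍ`. -/
def UnitTangent (Γ : Subgroup SL2R) : Type := Quotient (MulAction.orbitRel Γ SL2R)

variable (Γ : Subgroup SL2R)

/-- The quotient topology. -/
instance instTopologicalSpaceUnitTangent : TopologicalSpace (UnitTangent Γ) :=
  inferInstanceAs (TopologicalSpace (Quotient (MulAction.orbitRel Γ SL2R)))

/-- The Borel σ-algebra. -/
instance instMeasurableSpaceUnitTangent : MeasurableSpace (UnitTangent Γ) :=
  borel (UnitTangent Γ)

instance instBorelSpaceUnitTangent : BorelSpace (UnitTangent Γ) := ⟨rfl⟩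

/-- The projection `g ↦ Γ g`. -/
def proj (g : SL2R) : UnitTangent Γ := Quotient.mk (MulAction.orbitRel Γ SL2R) g

variable {Γ}

/-- Right translation `Γ g ↦ Γ g h`. -/
def rightTranslate (h : SL2R) : UnitTangent Γ → UnitTangent Γ :=
  Quotient.map (fun g => g * h) (by
    rintro _ b ⟨γ, rfl⟩
    exact ⟨γ, (smul_mul_assoc γ b h).symm⟩)

/-- The geodesic flow `φ_t`. -/
def geodesicFlow (t : ℝ) : UnitTangent Γ → UnitTangent Γ := rightTranslate (geodesicMatrix t)

/-- The unstable horocycle flow `h⁺_s`. -/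
def unstableFlow (s : ℝ) : UnitTangent Γ → UnitTangent Γ := rightTranslate (unstableMatrix s)

/-- The stable horocycle flow `h⁻_s`. -/
def stableFlow (s : ℝ) : UnitTangent Γ → UnitTangent Γ := rightTranslate (stableMatrix s)

variable (Γ) in
/-- `μ` is the normalised Liouville measure on `Γ \ SL(2, ℝ)`: the projection of the restriction
to a fundamental domain of `Γ` of the Haar measure that gives this fundamental domain mass one.
(Such a measure exists if and only if the surface `Γ \ ℍ` has finite area.) -/
def IsLiouville (μ : Measure (UnitTangent Γ)) : Prop :=
  ∃ (haar : Measure SL2R) (F : Set SL2R), haar.IsHaarMeasure ∧ IsFundamentalDomain Γ F haar ∧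
    haar F = 1 ∧ μ = (haar.restrict F).map (proj Γ)

/-- Admissible initial distributions: `lam (φ_t E) → μ E` as `t → ∞` for every Borel set `E` with
boundary of `μ`-measure zero. -/
def Admissible (μ lam : Measure (UnitTangent Γ)) : Prop :=
  ∀ E : Set (UnitTangent Γ), MeasurableSet E → μ (frontier E) = 0 →
    Tendsto (fun t : ℝ => lam (geodesicFlow t '' E)) atTop (𝓝 (μ E))

variable (Γ) in
/-- `c 0, …, c (K - 1)` is a complete list of the cusps of the surface `Γ \ ℍ`, each listed once,
i.e. a system of representatives of the `Γ`-orbits of fixed points of parabolic elements. -/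
structure IsCuspSystem {K : ℕ} (c : Fin K → OnePoint ℝ) : Prop where
  isCusp : ∀ κ, IsCusp (c κ) (Γ.map Matrix.SpecialLinearGroup.toGL)
  existsUnique : ∀ c' : OnePoint ℝ, IsCusp c' (Γ.map Matrix.SpecialLinearGroup.toGL) →
    ∃! κ, ∃ γ ∈ Γ, Matrix.SpecialLinearGroup.toGL γ • c' = c κ

/-- `x` lies on the closed stable horocycle of length one around the cusp `c`: the unit tangent
vector `x = Γ g` points to the cusp `c = g ∞`, and its orbit under the stable horocycle flow is
periodic with minimal period one. -/
def OnUnitHorocycle (c : OnePoint ℝ) (x : UnitTangent Γ) : Prop :=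
  (∃ g : SL2R, proj Γ g = x ∧ Matrix.SpecialLinearGroup.toGL g • OnePoint.infty = c) ∧
    ∀ s : ℝ, stableFlow s x = x ↔ ∃ m : ℤ, s = m

/-- The stable horocycle through `x`. -/
def stableHorocycle (x : UnitTangent Γ) : Set (UnitTangent Γ) := range fun s : ℝ => stableFlow s x

/-- The section `⋃_{t ≥ R} φ_t 𝒞` above the stable horocycle `𝒞` through `x`. -/
def cuspSection (x : UnitTangent Γ) (R : ℝ) : Set (UnitTangent Γ) :=
  {y | ∃ t ≥ R, y ∈ geodesicFlow t '' stableHorocycle x}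

variable {K : ℕ}

/-- The multi-cusp section `ℋ(σ, R)`, the union over `κ` of the sections at height `σ κ + R`. -/
def multiSection (x : Fin K → UnitTangent Γ) (σ : Fin K → ℝ) (R : ℝ) : Set (UnitTangent Γ) :=
  ⋃ κ, cuspSection (x κ) (σ κ + R)

/-- The parameter space `Σ^K(σ)` of triples `(s, t, κ)` with `0 ≤ s < 1` and `t ≥ σ κ`. -/
def sectionParam (σ : Fin K → ℝ) : Set (ℝ × ℝ × Fin K) :=
  {p | p.1 ∈ Ico (0 : ℝ) 1 ∧ σ p.2.2 ≤ p.2.1}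

/-- The parametrisation `(s, t, κ) ↦ φ_{t + R} (h⁻_s (x κ))` of the section `ℋ(σ, R)`. -/
def sectionEmbed (x : Fin K → UnitTangent Γ) (R : ℝ) (p : ℝ × ℝ × Fin K) : UnitTangent Γ :=
  geodesicFlow (p.2.1 + R) (stableFlow p.1 (x p.2.2))

/-- The `j`-th hitting time `ξ_j`, `j = 1, 2, …`, of the section `ℋ(σ, R)` for the orbit of `x₀`
under the unstable horocycle flow, counted from time `0` on (the value at `j = 0` is the starting
time `0`); it is `⊤` if there are fewer than `j` hits. -/
def hittingTime (x : Fin K → UnitTangent Γ) (σ : Fin K → ℝ) (R : ℝ) (x₀ : UnitTangent Γ) :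
    ℕ → EReal
  | 0 => 0
  | j + 1 => sInf {ξ : EReal | ∃ r : ℝ, ξ = r ∧ hittingTime x σ R x₀ j < r ∧
      unstableFlow r x₀ ∈ multiSection x σ R}

/-- `p = (w, κ) ∈ Σ^K(σ)` is the impact parameter `(w_j, κ_j)` of the `j`-th hit: the location of
the `j`-th hit on `ℋ(σ, R)` is the point with coordinates `p`. -/
def IsImpact (x : Fin K → UnitTangent Γ) (σ : Fin K → ℝ) (R : ℝ) (x₀ : UnitTangent Γ) (j : ℕ)
    (p : ℝ × ℝ × Fin K) : Prop :=
  p ∈ sectionParam σ ∧ ∃ r : ℝ, hittingTime x σ R x₀ j = r ∧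
    sectionEmbed x R p = unstableFlow r x₀

/-- The number of `j = 1, 2, …` with `e^{-R} ξ_j(x₀, σ, R) ≤ T` and
`(w_j(x₀, σ, R), κ_j(x₀, σ, R)) ∈ D`. -/
def hitCount (x : Fin K → UnitTangent Γ) (σ : Fin K → ℝ) (R : ℝ) (T : ℝ)
    (D : Set (ℝ × ℝ × Fin K)) (x₀ : UnitTangent Γ) : ℕ∞ :=
  {j : ℕ | 1 ≤ j ∧ (Real.exp (-R) : EReal) * hittingTime x σ R x₀ j ≤ (T : EReal) ∧
    ∃ p ∈ D, IsImpact x σ R x₀ j p}.encard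

/-- Lebesgue measure on `ℝ × ℝ × {1, …, K}`: two-dimensional Lebesgue measure on each of the `K`
sheets. -/
def sheetVolume (K : ℕ) : Measure (ℝ × ℝ × Fin K) :=
  (volume : Measure ℝ).prod ((volume : Measure ℝ).prod Measure.count)

end

end HorocycleFlow

open HorocycleFlow

/-! The geodesic flow `φ_R` conjugates the unstable horocycle flow to itself at speed `e^{-R}` and
maps `ℋ(σ, 0)` to `ℋ(σ, R)`, so the event at height `R` is the image under `φ_R` of the fixed event
`E` at height `0`. Admissibility then gives the limit as soon as `μ (∂E) = 0`.

To see that `∂E` is null, write `x κ = Γ w_κ`. The hits of the orbit of `Γ g` correspond to those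
matrices `w_κ⁻¹ γ g` with `γ ∈ Γ` that factor as `n₋(s) a(t) n₊(-r)` with `(s, t, κ) ∈ D` and
`0 < r ≤ T`. For `g` in a compact set, only finitely many bottom rows of matrices `w_κ⁻¹ γ` can give
a hit: since `M⁻¹ n₋(1) M` depends only on the bottom row of `M` and determines that row up to
finitely many choices, infinitely many such rows would give infinitely many elements of `Γ` in a
compact set. Two matrices `w_κ⁻¹ γ` with the same bottom row differ by some `n₋(m)` with `m ∈ ℤ`,
which leaves the hit unchanged once `D` is made periodic in `s`. Hence the numbers of hits are
locally constant in `g`, except where some `w_κ⁻¹ γ g` lies on the boundary of the region of hits,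
and this happens on a null set only.
-/

namespace HorocycleFlow

section SuccessiveTimes

/-- The `j`-th smallest positive element `τ_j` of a set `A` of times, with `τ_0 = 0` and `τ_j = ⊤`
if there are fewer than `j` positive elements. This is `hittingTime` for an arbitrary set of times
in place of the set of hits. -/
noncomputable def successiveTime (A : Set ℝ) : ℕ → EReal
  | 0 => 0
  | j + 1 => sInf {ξ : EReal | ∃ r : ℝ, ξ = r ∧ successiveTime A j < r ∧ r ∈ A}

variable {A : Set ℝ}

lemma successiveTime_monotone : Monotone (successiveTime A) := by
  refine monotone_nat_of_le_succ fun j => le_sInf ?_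
  rintro _ ⟨r, rfl, hr, -⟩
  exact hr.le

lemma successiveTime_nonneg (j : ℕ) : 0 ≤ successiveTime A j :=
  successiveTime_monotone (Nat.zero_le j)

lemma successiveTime_succ_le {j : ℕ} {r : ℝ} (hr : r ∈ A) (h : successiveTime A j < r) :
    successiveTime A (j + 1) ≤ r :=
  sInf_le ⟨r, rfl, h, hr⟩

lemma strictMono_coe_mul {c : ℝ} (hc : 0 < c) : StrictMono fun a : EReal => (c : EReal) * a := by
  have hc' : (0 : EReal) < c := EReal.coe_pos.2 hc
  have hcancel (a : EReal) : (c : EReal) * a / c = a := by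
    rw [← EReal.mul_div, EReal.mul_div_cancel (EReal.coe_ne_bot c) (EReal.coe_ne_top c) hc'.ne']
  intro a b hab
  refine (EReal.strictMono_div_right_of_pos hc' (EReal.coe_ne_top c)).lt_iff_lt.1 ?_
  rwa [hcancel, hcancel]

lemma mul_successiveTime_preimage {c : ℝ} (hc : 0 < c) (A : Set ℝ) (j : ℕ) :
    (c : EReal) * successiveTime ((c * ·) ⁻¹' A) j = successiveTime A j := by
  have hc' : (0 : EReal) < c := EReal.coe_pos.2 hc
  induction j with
  | zero => exact mul_zero _
  | succ j ih =>
    refine le_antisymm (le_sInf ?_) ?_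
    · rintro _ ⟨r, rfl, hlt, hr⟩
      have hcr : c * (r / c) = r := mul_div_cancel₀ r hc.ne'
      have hlt' : successiveTime ((c * ·) ⁻¹' A) j < (r / c : ℝ) := by
        rwa [EReal.coe_div, EReal.lt_div_iff hc' (EReal.coe_ne_top c), mul_comm, ih]
      calc (c : EReal) * successiveTime ((c * ·) ⁻¹' A) (j + 1)
          ≤ c * (r / c : ℝ) :=
            mul_le_mul_of_nonneg_left
              (successiveTime_succ_le (by rwa [mem_preimage, hcr]) hlt') hc'.le
        _ = r := by rw [← EReal.coe_mul, hcr]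
    · rw [← EReal.div_le_iff_le_mul hc' (EReal.coe_ne_top c)]
      refine le_sInf ?_
      rintro _ ⟨r, rfl, hlt, hr⟩
      rw [EReal.div_le_iff_le_mul hc' (EReal.coe_ne_top c), ← EReal.coe_mul]
      refine successiveTime_succ_le hr ?_
      rw [← ih, EReal.coe_mul]
      exact strictMono_coe_mul hc hlt

variable (hA : ∀ b, (A ∩ Ioc 0 b).Finite)
include hA

lemma successiveTime_succ_eq_top_or_isLeast (j : ℕ) :
    successiveTime A (j + 1) = ⊤ ∨
      ∃ r : ℝ, successiveTime A (j + 1) = r ∧ IsLeast {r ∈ A | successiveTime A j < r} r := by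
  obtain hempty | ⟨b, hbA, hb⟩ := {r ∈ A | successiveTime A j < r}.eq_empty_or_nonempty
  · refine Or.inl (sInf_eq_top.2 ?_)
    rintro _ ⟨r, rfl, hlt, hr⟩
    exact (hempty.subset ⟨hr, hlt⟩).elim
  · have hfin : ({r ∈ A | successiveTime A j < r} ∩ Iic b).Finite :=
      (hA b).subset fun r hr =>
        ⟨hr.1.1, EReal.coe_pos.1 ((successiveTime_nonneg j).trans_lt hr.1.2), hr.2⟩
    obtain ⟨m, ⟨hm, hmb⟩, hmin⟩ := exists_min_image _ id hfin ⟨b, ⟨hbA, hb⟩, self_mem_Iic⟩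
    have hleast : IsLeast {r ∈ A | successiveTime A j < r} m :=
      ⟨hm, fun r hr => (le_total r b).elim (fun hrb => hmin r ⟨hr, hrb⟩) hmb.trans⟩
    refine Or.inr ⟨m, le_antisymm (successiveTime_succ_le hm.1 hm.2) (le_sInf ?_), hleast⟩
    rintro _ ⟨r, rfl, hlt, hr⟩
    exact EReal.coe_le_coe_iff.2 (hleast.2 ⟨hr, hlt⟩)

lemma strictMonoOn_successiveTime :
    StrictMonoOn (successiveTime A) {j | successiveTime A j ≠ ⊤} := by
  intro i _ j hj hij
  obtain ⟨j, rfl⟩ := Nat.exists_eq_add_one_of_ne_zero (Nat.ne_zero_of_lt hij)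
  obtain htop | ⟨r, hr, hleast⟩ := successiveTime_succ_eq_top_or_isLeast hA j
  · exact absurd htop hj
  · exact hr ▸ (successiveTime_monotone (Nat.lt_succ_iff.1 hij)).trans_lt hleast.1.2

lemma mem_and_pos_of_successiveTime_eq {j : ℕ} (hj : 1 ≤ j) {r : ℝ}
    (hr : successiveTime A j = r) : r ∈ A ∧ 0 < r := by
  obtain ⟨j, rfl⟩ := Nat.exists_eq_add_of_le' hj
  obtain htop | ⟨s, hs, hleast⟩ := successiveTime_succ_eq_top_or_isLeast hA j
  · exact absurd (hr.symm.trans htop) (EReal.coe_ne_top r)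
  · obtain rfl : r = s := EReal.coe_injective (hr.symm.trans hs)
    exact ⟨hleast.1.1, EReal.coe_pos.1 ((successiveTime_nonneg j).trans_lt hleast.1.2)⟩

lemma exists_successiveTime_eq {r : ℝ} (hr : r ∈ A) (h0 : 0 < r) :
    ∃ j, 1 ≤ j ∧ successiveTime A j = r := by
  by_contra! hne
  have hlt (j : ℕ) : successiveTime A j < r := by
    induction j with
    | zero => exact EReal.coe_pos.2 h0
    | succ j ih => exact (successiveTime_succ_le hr ih).lt_of_ne (hne _ (Nat.le_add_left 1 j))
  have htop (j : ℕ) : successiveTime A j ≠ ⊤ := (hlt j).ne_top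
  have hcoe (j : ℕ) : successiveTime A j = (successiveTime A j).toReal :=
    (EReal.coe_toReal (htop j) ((EReal.bot_lt_zero.trans_le (successiveTime_nonneg j)).ne')).symm
  have hinj : Function.Injective fun j => (successiveTime A (j + 1)).toReal := by
    intro i j hij
    refine Nat.succ_injective ((strictMonoOn_successiveTime hA).injOn (htop _) (htop _) ?_)
    rw [Nat.succ_eq_add_one, Nat.succ_eq_add_one, hcoe (i + 1), hcoe (j + 1)]
    exact congrArg _ hij
  refine infinite_of_injective_forall_mem hinj (fun j => ?_) (hA r)
  obtain ⟨hmem, hpos⟩ := mem_and_pos_of_successiveTime_eq hA (Nat.le_add_left 1 j) (hcoe (j + 1))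
  exact ⟨hmem, hpos, EReal.coe_le_coe_iff.1 (hcoe (j + 1) ▸ (hlt (j + 1)).le)⟩

lemma encard_setOf_successiveTime (P : ℝ → Prop) :
    {j | 1 ≤ j ∧ ∃ r : ℝ, successiveTime A j = r ∧ P r}.encard =
      {r ∈ A | 0 < r ∧ P r}.encard := by
  have hinj : InjOn (fun j => (successiveTime A j).toReal)
      {j | 1 ≤ j ∧ ∃ r : ℝ, successiveTime A j = r ∧ P r} := by
    rintro i ⟨-, r, hr, -⟩ j ⟨-, s, hs, -⟩ hij
    simp only [hr, hs, EReal.toReal_coe] at hij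
    refine (strictMonoOn_successiveTime hA).injOn ?_ ?_ (by rw [hr, hs, hij]) <;>
      simp only [mem_ofPred_eq, hr, hs, ne_eq, EReal.coe_ne_top, not_false_eq_true]
  rw [← hinj.encard_image]
  congr 1
  ext r
  constructor
  · rintro ⟨j, ⟨hj, r, hr, hP⟩, rfl⟩
    simp only [hr, EReal.toReal_coe]
    obtain ⟨hmem, hpos⟩ := mem_and_pos_of_successiveTime_eq hA hj hr
    exact ⟨hmem, hpos, hP⟩
  · rintro ⟨hr, h0, hP⟩
    obtain ⟨j, hj, hjr⟩ := exists_successiveTime_eq hA hr h0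
    exact ⟨j, ⟨hj, r, hjr, hP⟩, by simp only [hjr, EReal.toReal_coe]⟩

end SuccessiveTimes

section Matrices

lemma mul_apply_fin_two {R : Type*} [CommRing R] (g h : Matrix.SpecialLinearGroup (Fin 2) R)
    (i j : Fin 2) : (g * h) i j = g i 0 * h 0 j + g i 1 * h 1 j := by
  rw [Matrix.SpecialLinearGroup.coe_mul, Matrix.mul_apply, Fin.sum_univ_two]

lemma det_fin_two_eq_one {R : Type*} [CommRing R] (g : Matrix.SpecialLinearGroup (Fin 2) R) :
    g 0 0 * g 1 1 - g 0 1 * g 1 0 = 1 := by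
  rw [← Matrix.det_fin_two, g.det_coe]

lemma ext_fin_two {R : Type*} [CommRing R] {g h : Matrix.SpecialLinearGroup (Fin 2) R}
    (h00 : g 0 0 = h 0 0) (h01 : g 0 1 = h 0 1) (h10 : g 1 0 = h 1 0) (h11 : g 1 1 = h 1 1) :
    g = h := by
  refine Matrix.SpecialLinearGroup.ext _ _ fun i j => ?_
  fin_cases i <;> fin_cases j <;> assumption

lemma ext_of_apply_one_one_ne_zero {R : Type*} [CommRing R] [IsDomain R]
    {g h : Matrix.SpecialLinearGroup (Fin 2) R} (h01 : g 0 1 = h 0 1) (h10 : g 1 0 = h 1 0)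
    (h11 : g 1 1 = h 1 1) (h0 : h 1 1 ≠ 0) : g = h := by
  refine ext_fin_two (mul_right_cancel₀ h0 ?_) h01 h10 h11
  have hg := det_fin_two_eq_one g
  rw [h01, h10, h11] at hg
  linear_combination hg - det_fin_two_eq_one h

lemma geodesicMatrix_apply (t : ℝ) (i j : Fin 2) :
    geodesicMatrix t i j = !![Real.exp (t / 2), 0; 0, Real.exp (-t / 2)] i j := rfl

lemma unstableMatrix_apply (s : ℝ) (i j : Fin 2) : unstableMatrix s i j = !![1, 0; -s, 1] i j := rfl

lemma stableMatrix_apply (s : ℝ) (i j : Fin 2) : stableMatrix s i j = !![1, s; 0, 1] i j := rfl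

attribute [local simp] mul_apply_fin_two geodesicMatrix_apply unstableMatrix_apply
  stableMatrix_apply

lemma geodesicMatrix_zero : geodesicMatrix 0 = 1 := by
  refine ext_fin_two ?_ ?_ ?_ ?_ <;> simp

lemma geodesicMatrix_add (s t : ℝ) :
    geodesicMatrix (s + t) = geodesicMatrix s * geodesicMatrix t := by
  refine ext_fin_two ?_ ?_ ?_ ?_ <;> simp [← Real.exp_add, add_div, add_comm]

lemma stableMatrix_add (s t : ℝ) : stableMatrix (s + t) = stableMatrix s * stableMatrix t := by
  refine ext_fin_two ?_ ?_ ?_ ?_ <;> simp [add_comm]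

lemma geodesicMatrix_mul_unstableMatrix (t r : ℝ) :
    geodesicMatrix t * unstableMatrix r =
      unstableMatrix (Real.exp (-t) * r) * geodesicMatrix t := by
  have h : Real.exp (-t / 2) = Real.exp (-t) * Real.exp (t / 2) := by
    rw [← Real.exp_add]
    ring_nf
  refine ext_of_apply_one_one_ne_zero ?_ ?_ ?_ ?_ <;> simp [h]
  ring

end Matrices

section Renormalisation

variable {Γ : Subgroup SL2R}

lemma proj_surjective : Function.Surjective (proj Γ) := Quotient.mk_surjective

lemma proj_eq_proj_iff {g h : SL2R} : proj Γ g = proj Γ h ↔ ∃ γ ∈ Γ, γ * h = g := by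
  refine (Quotient.eq (r := MulAction.orbitRel Γ SL2R)).trans ?_
  rw [MulAction.orbitRel_apply, MulAction.mem_orbit_iff]
  exact ⟨fun ⟨γ, hγ⟩ => ⟨γ, γ.2, hγ⟩, fun ⟨γ, hγ, h⟩ => ⟨⟨γ, hγ⟩, h⟩⟩

lemma rightTranslate_proj (h g : SL2R) : rightTranslate h (proj Γ g) = proj Γ (g * h) := rfl

lemma rightTranslate_one (y : UnitTangent Γ) : rightTranslate 1 y = y := by
  obtain ⟨g, rfl⟩ := proj_surjective y
  rw [rightTranslate_proj, mul_one]

lemma rightTranslate_rightTranslate (h h' : SL2R) (y : UnitTangent Γ) :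
    rightTranslate h' (rightTranslate h y) = rightTranslate (h * h') y := by
  obtain ⟨g, rfl⟩ := proj_surjective y
  simp only [rightTranslate_proj, mul_assoc]

lemma geodesicFlow_geodesicFlow (s t : ℝ) (y : UnitTangent Γ) :
    geodesicFlow s (geodesicFlow t y) = geodesicFlow (t + s) y := by
  rw [geodesicFlow, geodesicFlow, rightTranslate_rightTranslate, ← geodesicMatrix_add, geodesicFlow]

lemma geodesicFlow_zero (y : UnitTangent Γ) : geodesicFlow 0 y = y := by
  rw [geodesicFlow, geodesicMatrix_zero, rightTranslate_one]

lemma geodesicFlow_geodesicFlow_neg (t : ℝ) (y : UnitTangent Γ) :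
    geodesicFlow t (geodesicFlow (-t) y) = y := by
  rw [geodesicFlow_geodesicFlow, neg_add_cancel, geodesicFlow_zero]

lemma geodesicFlow_injective (t : ℝ) :
    Function.Injective (geodesicFlow t : UnitTangent Γ → UnitTangent Γ) :=
  Function.LeftInverse.injective (g := geodesicFlow (-t)) fun y => by
    rw [geodesicFlow_geodesicFlow, add_neg_cancel, geodesicFlow_zero]

lemma unstableFlow_geodesicFlow (R r : ℝ) (y : UnitTangent Γ) :
    unstableFlow r (geodesicFlow R y) = geodesicFlow R (unstableFlow (Real.exp (-R) * r) y) := by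
  simp only [geodesicFlow, unstableFlow, rightTranslate_rightTranslate,
    geodesicMatrix_mul_unstableMatrix]

variable {K : ℕ} {x : Fin K → UnitTangent Γ} {σ : Fin K → ℝ}

lemma sectionEmbed_eq_geodesicFlow (R : ℝ) (p : ℝ × ℝ × Fin K) :
    sectionEmbed x R p = geodesicFlow R (sectionEmbed x 0 p) := by
  rw [sectionEmbed, sectionEmbed, geodesicFlow_geodesicFlow, add_zero]

lemma mem_multiSection_iff {R : ℝ} {y : UnitTangent Γ} :
    y ∈ multiSection x σ R ↔
      ∃ p : ℝ × ℝ × Fin K, σ p.2.2 ≤ p.2.1 ∧ sectionEmbed x R p = y := by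
  constructor
  · intro hy
    obtain ⟨κ, t, ht, _, ⟨s, rfl⟩, hst⟩ := mem_iUnion.1 hy
    refine ⟨(s, t - R, κ), le_sub_iff_add_le.2 ht, ?_⟩
    rwa [sectionEmbed, sub_add_cancel]
  · rintro ⟨p, hp, rfl⟩
    exact mem_iUnion.2 ⟨p.2.2, p.2.1 + R, add_le_add_left hp R, _, ⟨p.1, rfl⟩, rfl⟩

lemma geodesicFlow_mem_multiSection_iff {R : ℝ} {y : UnitTangent Γ} :
    geodesicFlow R y ∈ multiSection x σ R ↔ y ∈ multiSection x σ 0 := by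
  simp only [mem_multiSection_iff, sectionEmbed_eq_geodesicFlow R,
    (geodesicFlow_injective R).eq_iff]

/-- The times at which the unstable horocycle orbit of `y` meets the section `ℋ(σ, R)`. -/
def visitTimes (x : Fin K → UnitTangent Γ) (σ : Fin K → ℝ) (R : ℝ) (y : UnitTangent Γ) : Set ℝ :=
  {r | unstableFlow r y ∈ multiSection x σ R}

lemma visitTimes_geodesicFlow (R : ℝ) (y : UnitTangent Γ) :
    visitTimes x σ R (geodesicFlow R y) = (Real.exp (-R) * ·) ⁻¹' visitTimes x σ 0 y := by
  ext r
  rw [visitTimes, mem_ofPred_eq, unstableFlow_geodesicFlow, geodesicFlow_mem_multiSection_iff]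
  rfl

lemma hittingTime_eq_successiveTime (R : ℝ) (y : UnitTangent Γ) :
    hittingTime x σ R y = successiveTime (visitTimes x σ R y) := by
  funext j
  induction j with
  | zero => rfl
  | succ j ih => rw [hittingTime, ih]; rfl

lemma mul_hittingTime_geodesicFlow (R : ℝ) (y : UnitTangent Γ) (j : ℕ) :
    (Real.exp (-R) : EReal) * hittingTime x σ R (geodesicFlow R y) j = hittingTime x σ 0 y j := by
  rw [hittingTime_eq_successiveTime, hittingTime_eq_successiveTime, visitTimes_geodesicFlow,
    mul_successiveTime_preimage (Real.exp_pos _)]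

lemma isImpact_geodesicFlow_iff {R : ℝ} {y : UnitTangent Γ} {j : ℕ} {p : ℝ × ℝ × Fin K} :
    IsImpact x σ R (geodesicFlow R y) j p ↔ IsImpact x σ 0 y j p := by
  have hsurj : Function.Surjective (Real.exp (-R) * ·) :=
    (mulLeft_bijective₀ _ (Real.exp_ne_zero _)).surjective
  refine and_congr_right fun _ => (exists_congr fun r => ?_).trans hsurj.exists.symm
  rw [sectionEmbed_eq_geodesicFlow R, unstableFlow_geodesicFlow, (geodesicFlow_injective R).eq_iff,
    ← mul_hittingTime_geodesicFlow R, EReal.coe_mul,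
    (strictMono_coe_mul (Real.exp_pos _)).injective.eq_iff]

lemma hitCount_geodesicFlow (R T : ℝ) (D : Set (ℝ × ℝ × Fin K)) (y : UnitTangent Γ) :
    hitCount x σ R T D (geodesicFlow R y) = hitCount x σ 0 T D y := by
  simp only [hitCount, mul_hittingTime_geodesicFlow, isImpact_geodesicFlow_iff, neg_zero,
    Real.exp_zero, EReal.coe_one, one_mul]

lemma setOf_hitCount_eq_image_geodesicFlow {ι : Type*} (R : ℝ) (T : ι → ℝ)
    (D : ι → Set (ℝ × ℝ × Fin K)) (k : ι → ℕ∞) :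
    {y | ∀ i, hitCount x σ R (T i) (D i) y = k i} =
      geodesicFlow R '' {y | ∀ i, hitCount x σ 0 (T i) (D i) y = k i} := by
  have hflow (y : UnitTangent Γ) := geodesicFlow_geodesicFlow_neg R y
  ext y
  constructor
  · intro hy
    refine ⟨geodesicFlow (-R) y, fun i => ?_, hflow y⟩
    rw [← hitCount_geodesicFlow R, hflow]
    exact hy i
  · rintro ⟨y, hy, rfl⟩ i
    rw [hitCount_geodesicFlow]
    exact hy i

end Renormalisation
section Coordinates

attribute [local simp] mul_apply_fin_two geodesicMatrix_apply unstableMatrix_apply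
  stableMatrix_apply

/-- The parameters `(s, t)` of `m = n₋(s) a(t) n₊(-r)`, where `n₋`, `a`, `n₊` are the stable,
geodesic and unstable matrices. Only meaningful if `0 < m 1 1`. -/
noncomputable def sectionCoord (m : SL2R) : ℝ × ℝ := (m 0 1 / m 1 1, -2 * Real.log (m 1 1))

/-- The parameter `r` of `m = n₋(s) a(t) n₊(-r)`. Only meaningful if `0 < m 1 1`. -/
noncomputable def timeCoord (m : SL2R) : ℝ := m 1 0 / m 1 1

lemma mul_unstableMatrix_eq_iff {m : SL2R} {s t r : ℝ} :
    m * unstableMatrix r = stableMatrix s * geodesicMatrix t ↔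
      0 < m 1 1 ∧ sectionCoord m = (s, t) ∧ timeCoord m = r := by
  have hexp := Real.exp_pos (-t / 2)
  constructor
  · intro h
    have entry (i j : Fin 2) := congrArg (fun g : SL2R => g i j) h
    have h01 : m 0 1 = s * Real.exp (-t / 2) := by simpa using entry 0 1
    have h10 : m 1 0 + -(m 1 1 * r) = 0 := by simpa using entry 1 0
    have h11 : m 1 1 = Real.exp (-t / 2) := by simpa using entry 1 1
    refine ⟨h11 ▸ hexp, Prod.ext ?_ ?_, ?_⟩
    · rw [sectionCoord, h01, h11, mul_div_cancel_right₀ _ hexp.ne']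
    · rw [sectionCoord, h11, Real.log_exp]
      ring
    · rw [timeCoord, div_eq_iff (h11 ▸ hexp.ne')]
      linear_combination h10
  · rintro ⟨hpos, hst, rfl⟩
    obtain ⟨hs, ht⟩ : m 0 1 / m 1 1 = s ∧ -2 * Real.log (m 1 1) = t := Prod.mk.inj hst
    have h01 : m 0 1 = s * m 1 1 := (div_eq_iff hpos.ne').1 hs
    have h10 : timeCoord m * m 1 1 = m 1 0 := div_mul_cancel₀ _ hpos.ne'
    have h11 : m 1 1 = Real.exp (-t / 2) := by
      rw [← ht, neg_mul, neg_neg, mul_div_cancel_left₀ _ two_ne_zero, Real.exp_log hpos]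
    refine ext_of_apply_one_one_ne_zero ?_ ?_ ?_ ?_ <;> simp [hpos.ne', ← h11, h01, h10, mul_comm]

lemma stableMatrix_mul_apply_one (s : ℝ) (m : SL2R) : (stableMatrix s * m) 1 = m 1 := by
  ext j
  simp

lemma geodesicMatrix_mul_apply_one_one (t : ℝ) (m : SL2R) :
    (geodesicMatrix t * m) 1 1 = Real.exp (-t / 2) * m 1 1 := by
  simp

lemma sectionCoord_stableMatrix_mul (s : ℝ) {m : SL2R} (hm : m 1 1 ≠ 0) :
    sectionCoord (stableMatrix s * m) = ((sectionCoord m).1 + s, (sectionCoord m).2) := by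
  simp [sectionCoord, add_div, hm]

lemma sectionCoord_geodesicMatrix_mul (t : ℝ) {m : SL2R} (hm : m 1 1 ≠ 0) :
    sectionCoord (geodesicMatrix t * m) =
      (Real.exp t * (sectionCoord m).1, (sectionCoord m).2 + t) := by
  have h : Real.exp (t / 2) = Real.exp t * Real.exp (-t / 2) := by
    rw [← Real.exp_add]
    ring_nf
  refine Prod.ext ?_ ?_
  · simp [sectionCoord, h]
    field_simp
  · simp [sectionCoord, Real.log_mul, hm]
    ring

lemma timeCoord_mul_eq_iff {M M' g : SL2R} (h : (M * g) 1 1 ≠ 0) (h' : (M' * g) 1 1 ≠ 0) :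
    timeCoord (M * g) = timeCoord (M' * g) ↔ M 1 0 * M' 1 1 = M' 1 0 * M 1 1 := by
  have hcross : (M * g) 1 0 * (M' * g) 1 1 - (M' * g) 1 0 * (M * g) 1 1 =
      M 1 0 * M' 1 1 - M' 1 0 * M 1 1 := by
    simp only [mul_apply_fin_two]
    linear_combination (M 1 0 * M' 1 1 - M' 1 0 * M 1 1) * det_fin_two_eq_one g
  rw [timeCoord, timeCoord, div_eq_div_iff h h', ← sub_eq_zero, hcross, sub_eq_zero]

lemma exists_eq_stableMatrix_mul {M M' : SL2R} (h : M 1 = M' 1) :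
    ∃ u, M' = stableMatrix u * M := by
  have h0 : M 1 0 = M' 1 0 := congrFun h 0
  have h1 : M 1 1 = M' 1 1 := congrFun h 1
  have hM := det_fin_two_eq_one M
  have hM' := det_fin_two_eq_one M'
  rw [← h0, ← h1] at hM'
  refine ⟨M' 0 1 * M 0 0 - M' 0 0 * M 0 1, ext_fin_two ?_ ?_ ?_ ?_⟩ <;> simp [← h0, ← h1]
  · linear_combination M 0 0 * hM' - M' 0 0 * hM
  · linear_combination M 0 1 * hM' - M' 0 1 * hM

lemma mul_apply_one_eq_vecMul (M g : SL2R) :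
    (M * g) 1 = Matrix.vecMul (M 1) (g : Matrix (Fin 2) (Fin 2) ℝ) := by
  rw [Matrix.SpecialLinearGroup.coe_mul, Matrix.mul_apply_eq_vecMul]

end Coordinates

section Hits

variable {Γ : Subgroup SL2R} {K : ℕ} {x : Fin K → UnitTangent Γ}

/-- `y` has minimal period one under the stable horocycle flow. -/
def IsUnitPeriodic (y : UnitTangent Γ) : Prop :=
  ∀ s : ℝ, stableFlow s y = y ↔ ∃ m : ℤ, s = m

lemma isUnitPeriodic_proj_iff {w : SL2R} :
    IsUnitPeriodic (proj Γ w) ↔ ∀ s : ℝ, w * stableMatrix s * w⁻¹ ∈ Γ ↔ ∃ m : ℤ, s = m := by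
  refine forall_congr' fun s => iff_congr ?_ Iff.rfl
  rw [stableFlow, rightTranslate_proj, proj_eq_proj_iff]
  constructor
  · rintro ⟨γ, hγ, h⟩
    rwa [← h, mul_inv_cancel_right]
  · intro h
    exact ⟨_, h, inv_mul_cancel_right _ _⟩

lemma IsUnitPeriodic.stableFlow_fract {y : UnitTangent Γ} (hy : IsUnitPeriodic y) (s : ℝ) :
    stableFlow (Int.fract s) y = stableFlow s y := by
  conv_rhs => rw [← Int.floor_add_fract s, stableFlow, stableMatrix_add,
    ← rightTranslate_rightTranslate]
  exact congrArg _ ((hy _).2 ⟨_, rfl⟩).symm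

/-- The times in `(0, T]` at which the unstable horocycle orbit of `y` passes through a point
`φ_t (h⁻_s (x κ))` with `(s, t, κ) ∈ D`. -/
def hitTimes (x : Fin K → UnitTangent Γ) (T : ℝ) (D : Set (ℝ × ℝ × Fin K)) (y : UnitTangent Γ) :
    Set ℝ :=
  {r | r ∈ Ioc 0 T ∧ ∃ p ∈ D, sectionEmbed x 0 p = unstableFlow r y}

lemma visitTimes_inter_Ioc (σ : Fin K → ℝ) (T : ℝ) (y : UnitTangent Γ) :
    visitTimes x σ 0 y ∩ Ioc 0 T = hitTimes x T {p | σ p.2.2 ≤ p.2.1} y := by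
  ext r
  rw [mem_inter_iff, and_comm, visitTimes, mem_ofPred_eq, mem_multiSection_iff]
  rfl

lemma hitCount_zero_eq_encard_hitTimes {σ : Fin K → ℝ} {D : Set (ℝ × ℝ × Fin K)}
    (hD : D ⊆ sectionParam σ) {y : UnitTangent Γ}
    (hfin : ∀ b, (visitTimes x σ 0 y ∩ Ioc 0 b).Finite) (T : ℝ) :
    hitCount x σ 0 T D y = (hitTimes x T D y).encard := by
  have hcount : hitCount x σ 0 T D y = {j | 1 ≤ j ∧ ∃ r : ℝ,
      successiveTime (visitTimes x σ 0 y) j = r ∧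
        (r ≤ T ∧ ∃ p ∈ D, sectionEmbed x 0 p = unstableFlow r y)}.encard := by
    rw [hitCount]
    congr 1
    ext j
    refine and_congr_right fun _ => ?_
    rw [neg_zero, Real.exp_zero, EReal.coe_one, one_mul, hittingTime_eq_successiveTime]
    constructor
    · rintro ⟨hle, p, hp, -, r, hr, hpr⟩
      rw [hittingTime_eq_successiveTime] at hr
      exact ⟨r, hr, EReal.coe_le_coe_iff.1 (hr ▸ hle), p, hp, hpr⟩
    · rintro ⟨r, hr, hle, p, hp, hpr⟩
      refine ⟨hr ▸ EReal.coe_le_coe_iff.2 hle, p, hp, hD hp, r, ?_, hpr⟩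
      rw [hittingTime_eq_successiveTime, hr]
  rw [hcount, encard_setOf_successiveTime hfin]
  congr 1
  ext r
  constructor
  · rintro ⟨-, hpos, hle, hp⟩
    exact ⟨⟨hpos, hle⟩, hp⟩
  · rintro ⟨⟨hpos, hle⟩, p, hp, hpr⟩
    exact ⟨mem_multiSection_iff.2 ⟨p, (hD hp).2, hpr⟩, hpos, hle, p, hp, hpr⟩

/-- The subset of `ℝ × α` that is `1`-periodic in the first coordinate and agrees with `D` where
that coordinate is in `[0, 1)`. -/
def periodization {α : Type*} (D : Set (ℝ × α)) : Set (ℝ × α) := {p | (Int.fract p.1, p.2) ∈ D}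

lemma hitTimes_periodization (hx : ∀ κ, IsUnitPeriodic (x κ)) {σ : Fin K → ℝ}
    {D : Set (ℝ × ℝ × Fin K)} (hD : D ⊆ sectionParam σ) (T : ℝ) (y : UnitTangent Γ) :
    hitTimes x T (periodization D) y = hitTimes x T D y := by
  ext r
  refine and_congr_right fun _ => ⟨?_, ?_⟩
  · rintro ⟨p, hp, hpr⟩
    refine ⟨_, hp, ?_⟩
    rwa [sectionEmbed, (hx _).stableFlow_fract]
  · rintro ⟨p, hp, hpr⟩
    refine ⟨p, ?_, hpr⟩
    rwa [periodization, mem_ofPred_eq, Int.fract_eq_self.2 (hD hp).1]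

/-- The matrices `n₋(s) a(t) n₊(-r)` with `(s, t) ∈ A` and `0 < r ≤ T`. -/
def hitRegion (T : ℝ) (A : Set (ℝ × ℝ)) : Set SL2R :=
  {m | 0 < m 1 1 ∧ timeCoord m ∈ Ioc 0 T ∧ sectionCoord m ∈ A}

/-- The part of `D` on the sheet labelled `κ`. -/
def sheet {ι : Type*} (D : Set (ℝ × ℝ × ι)) (κ : ι) : Set (ℝ × ℝ) := {q | (q.1, q.2, κ) ∈ D}

lemma hitTimes_proj (w : Fin K → SL2R) (T : ℝ) (D : Set (ℝ × ℝ × Fin K)) (g : SL2R) :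
    hitTimes (fun κ => proj Γ (w κ)) T D (proj Γ g) =
      (fun q : Fin K × Γ => timeCoord ((w q.1)⁻¹ * q.2 * g)) ''
        {q | (w q.1)⁻¹ * q.2 * g ∈ hitRegion T (sheet D q.1)} := by
  have hembed (p : ℝ × ℝ × Fin K) (r : ℝ) :
      sectionEmbed (fun κ => proj Γ (w κ)) 0 p = unstableFlow r (proj Γ g) ↔
        ∃ γ ∈ Γ, 0 < ((w p.2.2)⁻¹ * γ * g) 1 1 ∧
          sectionCoord ((w p.2.2)⁻¹ * γ * g) = (p.1, p.2.1) ∧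
          timeCoord ((w p.2.2)⁻¹ * γ * g) = r := by
    simp only [sectionEmbed, geodesicFlow, stableFlow, unstableFlow, rightTranslate_proj, add_zero,
      proj_eq_proj_iff, ← mul_unstableMatrix_eq_iff, mul_assoc, inv_mul_eq_iff_eq_mul]
  ext r
  constructor
  · rintro ⟨hr, p, hp, hpr⟩
    obtain ⟨γ, hγ, hpos, hst, rfl⟩ := (hembed p r).1 hpr
    exact ⟨(p.2.2, ⟨γ, hγ⟩), ⟨hpos, hr, by rw [hst]; exact hp⟩, rfl⟩
  · rintro ⟨⟨κ, γ⟩, ⟨hpos, hr, hA⟩, rfl⟩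
    exact ⟨hr, _, hA, (hembed _ _).2 ⟨γ, γ.2, hpos, rfl, rfl⟩⟩

end Hits

section Topology

variable {n R : Type*} [Fintype n] [DecidableEq n] [CommRing R] [TopologicalSpace R]

instance instSecondCountableTopologySpecialLinearGroup [SecondCountableTopology R] :
    SecondCountableTopology (Matrix.SpecialLinearGroup n R) :=
  have : SecondCountableTopology (Matrix n n R) :=
    inferInstanceAs (SecondCountableTopology (n → n → R))
  IsEmbedding.subtypeVal.secondCountableTopology

instance instLocallyCompactSpaceSpecialLinearGroup [IsTopologicalRing R] [T1Space R]
    [LocallyCompactSpace R] : LocallyCompactSpace (Matrix.SpecialLinearGroup n R) :=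
  have : LocallyCompactSpace (Matrix n n R) := inferInstanceAs (LocallyCompactSpace (n → n → R))
  Matrix.SpecialLinearGroup.isClosedEmbedding_val.locallyCompactSpace

lemma continuous_entry (i j : n) : Continuous fun g : Matrix.SpecialLinearGroup n R => g i j := by
  fun_prop

lemma continuous_of_forall_continuous_entry {X : Type*} [TopologicalSpace X]
    {f : X → Matrix.SpecialLinearGroup n R} (h : ∀ i j, Continuous fun x => f x i j) :
    Continuous f :=
  IsEmbedding.subtypeVal.continuous_iff.2 (continuous_matrix h)

lemma continuous_geodesicMatrix : Continuous geodesicMatrix := by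
  refine continuous_of_forall_continuous_entry fun i j => ?_
  simp only [geodesicMatrix_apply]
  fin_cases i <;> fin_cases j <;> dsimp <;> fun_prop

lemma continuous_unstableMatrix : Continuous unstableMatrix := by
  refine continuous_of_forall_continuous_entry fun i j => ?_
  simp only [unstableMatrix_apply]
  fin_cases i <;> fin_cases j <;> dsimp <;> fun_prop

lemma continuous_stableMatrix : Continuous stableMatrix := by
  refine continuous_of_forall_continuous_entry fun i j => ?_
  simp only [stableMatrix_apply]
  fin_cases i <;> fin_cases j <;> dsimp <;> fun_prop

lemma continuousAt_timeCoord {m : SL2R} (hm : m 1 1 ≠ 0) : ContinuousAt timeCoord m :=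
  (continuous_entry 1 0).continuousAt.div (continuous_entry 1 1).continuousAt hm

lemma continuousAt_sectionCoord {m : SL2R} (hm : m 1 1 ≠ 0) : ContinuousAt sectionCoord m :=
  ((continuous_entry 0 1).continuousAt.div (continuous_entry 1 1).continuousAt hm).prodMk
    (((continuous_entry 1 1).continuousAt.log hm).const_mul (-2))

lemma notMem_frontier_iff_eventually {X : Type*} [TopologicalSpace X] {s : Set X} {a : X} :
    a ∉ frontier s ↔ ∀ᶠ y in 𝓝 a, (y ∈ s ↔ a ∈ s) := by
  by_cases ha : a ∈ s
  · simp only [mem_frontier_iff_notMem_interior ha, not_not, mem_interior_iff_mem_nhds, ha,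
      iff_true, eventually_mem_set]
  · have ha' : a ∈ sᶜ := ha
    rw [← frontier_compl]
    simp only [mem_frontier_iff_notMem_interior ha', not_not, mem_interior_iff_mem_nhds, ha,
      iff_false, ← mem_compl_iff, eventually_mem_set]

lemma frontier_Ioc_subset_pair {α : Type*} [LinearOrder α] [DenselyOrdered α] [NoMaxOrder α]
    [TopologicalSpace α] [OrderTopology α] (a b : α) :
    frontier (Ioc a b) ⊆ {a, b} := by
  obtain h | h := lt_or_ge a b
  · exact (frontier_Ioc h).subset
  · simp [Ioc_eq_empty h.not_gt]

lemma frontier_hitRegion_subset (T : ℝ) (A : Set (ℝ × ℝ)) :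
    frontier (hitRegion T A) ⊆ ({m | m 1 1 = 0} ∪ {m | m 1 0 = 0} ∪ {m | m 1 0 = T * m 1 1}) ∪
      {m | 0 < m 1 1 ∧ sectionCoord m ∈ frontier A} := by
  refine compl_subset_compl.1 fun m hm => notMem_frontier_iff_eventually.2 ?_
  simp only [mem_compl_iff, mem_union, mem_ofPred_eq, not_or, not_and] at hm
  obtain ⟨⟨⟨h11, h10⟩, hT⟩, hA⟩ := hm
  have hcont := (continuous_entry (R := ℝ) (1 : Fin 2) 1).continuousAt (x := m)
  obtain hneg | hpos := lt_or_gt_of_ne h11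
  · filter_upwards [hcont.eventually_lt_const hneg] with m' hm'
    exact iff_of_false (fun h => h.1.not_gt hm') (fun h => h.1.not_gt hneg)
  · have htime : timeCoord m ∉ frontier (Ioc 0 T) := fun h => by
      obtain h0 | h0 := frontier_Ioc_subset_pair 0 T h
      · exact h10 ((div_eq_zero_iff.1 h0).resolve_right h11)
      · exact hT ((div_eq_iff h11).1 h0)
    filter_upwards [hcont.eventually_const_lt hpos,
      (continuousAt_timeCoord h11).eventually (notMem_frontier_iff_eventually.1 htime),
      (continuousAt_sectionCoord h11).eventually (notMem_frontier_iff_eventually.1 (hA hpos))]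
      with m' hm' ht hc
    exact and_congr (iff_of_true hm' hpos) (and_congr ht hc)

end Topology

section LocalConstancy

variable {Γ : Subgroup SL2R} [DiscreteTopology Γ] {w : SL2R}

/-- The unipotent matrix `M⁻¹ n₋(1) M`, which depends on `M` only through its bottom row `v`. -/
def rowUnipotent (v : Fin 2 → ℝ) : SL2R :=
  ⟨!![1 + v 0 * v 1, v 1 ^ 2; -v 0 ^ 2, 1 - v 0 * v 1], by rw [Matrix.det_fin_two_of]; ring⟩

lemma rowUnipotent_apply (v : Fin 2 → ℝ) (i j : Fin 2) :
    rowUnipotent v i j = !![1 + v 0 * v 1, v 1 ^ 2; -v 0 ^ 2, 1 - v 0 * v 1] i j := rfl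

lemma continuous_rowUnipotent : Continuous rowUnipotent := by
  refine continuous_of_forall_continuous_entry fun i j => ?_
  simp only [rowUnipotent_apply]
  fin_cases i <;> fin_cases j <;> dsimp <;> fun_prop

lemma inv_mul_stableMatrix_mul (M : SL2R) : M⁻¹ * stableMatrix 1 * M = rowUnipotent (M 1) := by
  have hdet := det_fin_two_eq_one M
  rw [mul_assoc, inv_mul_eq_iff_eq_mul]
  refine ext_fin_two ?_ ?_ ?_ ?_ <;>
    simp only [mul_apply_fin_two, stableMatrix_apply, rowUnipotent_apply, Matrix.of_apply,
      Matrix.cons_val', Matrix.cons_val_zero, Matrix.cons_val_one, Matrix.cons_val_fin_one]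
  · linear_combination -M 1 0 * hdet
  · linear_combination -M 1 1 * hdet
  · ring
  · ring

lemma finite_preimage_rowUnipotent (m : SL2R) : (rowUnipotent ⁻¹' {m}).Finite := by
  have hroots (c : ℝ) : {y : ℝ | y ^ 2 = c}.Finite := by
    refine (toFinite {√c, -√c}).subset ?_
    rintro y rfl
    exact eq_or_eq_neg_of_abs_eq (Real.sqrt_sq_eq_abs y).symm
  refine (Finite.pi' fun i => hroots (![-m 1 0, m 0 1] i)).subset ?_
  rintro v rfl i
  fin_cases i <;> simp [rowUnipotent_apply]

lemma finite_setOf_apply_one_mem {B : Set (Fin 2 → ℝ)}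
    (hw : w * stableMatrix 1 * w⁻¹ ∈ Γ) (hB : IsCompact B) :
    {v | (∃ γ ∈ Γ, (w⁻¹ * γ) 1 = v) ∧ v ∈ B}.Finite := by
  have hΓ : ((Γ : Set SL2R) ∩ rowUnipotent '' B).Finite :=
    ((hB.image continuous_rowUnipotent).inter_left Subgroup.isClosed_of_discrete).finite
      (DiscreteTopology.isDiscrete.mono inter_subset_left)
  refine (hΓ.preimage' fun m _ => finite_preimage_rowUnipotent m).subset ?_
  rintro _ ⟨⟨γ, hγ, rfl⟩, hv⟩
  refine ⟨?_, mem_image_of_mem _ hv⟩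
  have hconj : (w⁻¹ * γ)⁻¹ * stableMatrix 1 * (w⁻¹ * γ) =
      γ⁻¹ * (w * stableMatrix 1 * w⁻¹) * γ := by
    group
  rw [← inv_mul_stableMatrix_mul, hconj]
  exact mul_mem (mul_mem (inv_mem hγ) hw) hγ

lemma finite_setOf_exists_mul_apply_one_mem {U : Set SL2R} {B : Set (Fin 2 → ℝ)}
    (hw : w * stableMatrix 1 * w⁻¹ ∈ Γ) (hU : IsCompact U) (hB : IsCompact B) :
    {v | ∃ γ ∈ Γ, (w⁻¹ * γ) 1 = v ∧ ∃ g ∈ U, (w⁻¹ * γ * g) 1 ∈ B}.Finite := by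
  have hcont : Continuous fun q : (Fin 2 → ℝ) × SL2R =>
      Matrix.vecMul q.1 ((q.2⁻¹ : SL2R) : Matrix (Fin 2) (Fin 2) ℝ) :=
    continuous_fst.matrix_vecMul (by fun_prop)
  refine (finite_setOf_apply_one_mem hw ((hB.prod hU).image hcont)).subset ?_
  rintro _ ⟨γ, hγ, rfl, g, hg, hB⟩
  have hback : Matrix.vecMul ((w⁻¹ * γ * g) 1) ((g⁻¹ : SL2R) : Matrix (Fin 2) (Fin 2) ℝ) =
      (w⁻¹ * γ) 1 := by
    rw [← mul_apply_one_eq_vecMul, mul_inv_cancel_right]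
  exact ⟨⟨γ, hγ, rfl⟩, ⟨_, g⟩, ⟨hB, hg⟩, hback⟩

lemma eventually_forall_mul_mem_iff {S : Set SL2R} {B : Set (Fin 2 → ℝ)} {g : SL2R}
    (hw : ∀ s : ℝ, w * stableMatrix s * w⁻¹ ∈ Γ ↔ ∃ m : ℤ, s = m)
    (hS : ∀ (m : ℤ) M, stableMatrix m * M ∈ S ↔ M ∈ S) (hB : IsCompact B)
    (hSB : ∀ M ∈ S, M 1 ∈ B) (hg : ∀ γ ∈ Γ, w⁻¹ * γ * g ∉ frontier S) :
    ∀ᶠ g' in 𝓝 g, ∀ γ ∈ Γ, w⁻¹ * γ * g' ∈ S ↔ w⁻¹ * γ * g ∈ S := by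
  obtain ⟨U, hU, hgU⟩ := exists_compact_mem_nhds g
  have hrows := finite_setOf_exists_mul_apply_one_mem ((hw 1).2 ⟨1, by simp⟩) hU hB
  have hnear : ∀ᶠ g' in 𝓝 g, ∀ v ∈ {v | ∃ γ ∈ Γ, (w⁻¹ * γ) 1 = v ∧ ∃ g ∈ U, (w⁻¹ * γ * g) 1 ∈ B},
      ∀ γ ∈ Γ, (w⁻¹ * γ) 1 = v → (w⁻¹ * γ * g' ∈ S ↔ w⁻¹ * γ * g ∈ S) := by
    rw [eventually_all_finite hrows]
    rintro _ ⟨γ₀, hγ₀, rfl, -⟩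
    filter_upwards [(continuous_const_mul (w⁻¹ * γ₀)).continuousAt.eventually
      (notMem_frontier_iff_eventually.1 (hg γ₀ hγ₀))] with g' hg' γ hγ hrow
    obtain ⟨u, hu⟩ := exists_eq_stableMatrix_mul hrow.symm
    obtain ⟨m, rfl⟩ := (hw u).1 <| by
      have hconj : w * stableMatrix u * w⁻¹ = γ * γ₀⁻¹ := by
        rw [eq_mul_inv_iff_mul_eq, mul_assoc, mul_assoc, ← hu, mul_inv_cancel_left]
      exact hconj ▸ mul_mem hγ (inv_mem hγ₀)
    simpa only [hu, mul_assoc, hS] using hg'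
  filter_upwards [hnear, hgU] with g' hg' hg'U γ hγ
  by_cases hex : ∃ h ∈ U, (w⁻¹ * γ * h) 1 ∈ B
  · exact hg' _ ⟨γ, hγ, rfl, hex⟩ γ hγ rfl
  · exact iff_of_false (fun h => hex ⟨g', hg'U, hSB _ h⟩)
      fun h => hex ⟨g, mem_of_mem_nhds hgU, hSB _ h⟩

lemma stableMatrix_mul_mem_hitRegion_periodization_iff {T : ℝ} {A : Set (ℝ × ℝ)} (m : ℤ)
    (M : SL2R) :
    stableMatrix m * M ∈ hitRegion T (periodization A) ↔ M ∈ hitRegion T (periodization A) := by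
  simp only [hitRegion, periodization, mem_ofPred_eq, timeCoord, stableMatrix_mul_apply_one]
  refine and_congr_right fun hpos => ?_
  rw [sectionCoord_stableMatrix_mul _ hpos.ne', Int.fract_add_intCast]

lemma apply_one_mem_Icc_of_mem_hitRegion {T s : ℝ} {A : Set (ℝ × ℝ)} (hA : ∀ q ∈ A, s ≤ q.2)
    {M : SL2R} (hM : M ∈ hitRegion T A) :
    M 1 ∈ Icc 0 ![T * Real.exp (-s / 2), Real.exp (-s / 2)] := by
  obtain ⟨hpos, ⟨h0, hT⟩, hMA⟩ := hM
  have hlog : s ≤ -2 * Real.log (M 1 1) := hA _ hMA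
  have h11 : M 1 1 ≤ Real.exp (-s / 2) := (Real.log_le_iff_le_exp hpos).1 (by linarith)
  have h10 : M 1 0 = timeCoord M * M 1 1 := (div_mul_cancel₀ _ hpos.ne').symm
  have h10_le : M 1 0 ≤ T * Real.exp (-s / 2) := by
    rw [h10]
    exact mul_le_mul hT h11 hpos.le (h0.le.trans hT)
  constructor <;> intro j <;> fin_cases j
  · exact h10 ▸ (mul_pos h0 hpos).le
  · exact hpos.le
  · exact h10_le
  · exact h11

lemma encard_image_eq_encard_image {α β γ : Type*} {s : Set α} {f : α → β} {f' : α → γ}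
    (h : ∀ a ∈ s, ∀ b ∈ s, f a = f b ↔ f' a = f' b) : (f '' s).encard = (f' '' s).encard := by
  obtain ⟨t, hts, ht⟩ := exists_subset_bijOn s f
  have hinj : InjOn f' t := fun a ha b hb hab => ht.injOn ha hb ((h a (hts ha) b (hts hb)).2 hab)
  have himage : f' '' s = f' '' t := by
    refine (image_subset_iff.2 fun a ha => ?_).antisymm (image_mono hts)
    obtain ⟨b, hb, hab⟩ := ht.surjOn ⟨a, ha, rfl⟩
    exact ⟨b, hb, (h b (hts hb) a ha).1 hab⟩
  rw [himage, hinj.encard_image, ← ht.image_eq, ht.injOn.encard_image]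

variable {K : ℕ} {σ : Fin K → ℝ} {T : ℝ} {D : Set (ℝ × ℝ × Fin K)}

lemma finite_hitTimes {x : Fin K → UnitTangent Γ} (hx : ∀ κ, IsUnitPeriodic (x κ))
    (hD : ∀ p ∈ D, σ p.2.2 ≤ p.2.1) (y : UnitTangent Γ) : (hitTimes x T D y).Finite := by
  choose w hw using fun κ => proj_surjective (x κ)
  obtain rfl : (fun κ => proj Γ (w κ)) = x := funext hw
  obtain ⟨g, rfl⟩ := proj_surjective y
  have hrows (κ : Fin K) := finite_setOf_exists_mul_apply_one_mem
    ((isUnitPeriodic_proj_iff.1 (hx κ) 1).2 ⟨1, by simp⟩) (isCompact_singleton (x := g))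
    (isCompact_Icc (a := 0) (b := ![T * Real.exp (-σ κ / 2), Real.exp (-σ κ / 2)]))
  refine (finite_iUnion fun κ => (hrows κ).image fun v =>
    Matrix.vecMul v (g : Matrix (Fin 2) (Fin 2) ℝ) 0 /
      Matrix.vecMul v (g : Matrix (Fin 2) (Fin 2) ℝ) 1).subset ?_
  rw [hitTimes_proj]
  rintro _ ⟨⟨κ, γ⟩, hhit, rfl⟩
  refine mem_iUnion.2 ⟨κ, _, ⟨γ, γ.2, rfl, g, rfl,
    apply_one_mem_Icc_of_mem_hitRegion (fun q hq => hD _ hq) hhit⟩, ?_⟩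
  simp only [← mul_apply_one_eq_vecMul]
  rfl

lemma eventually_encard_hitTimes_eq {w : Fin K → SL2R}
    (hw : ∀ κ, IsUnitPeriodic (proj Γ (w κ))) (hD : ∀ p ∈ D, σ p.2.2 ≤ p.2.1) {g : SL2R}
    (hg : ∀ κ, ∀ γ ∈ Γ, (w κ)⁻¹ * γ * g ∉ frontier (hitRegion T (sheet (periodization D) κ))) :
    ∀ᶠ g' in 𝓝 g,
      (hitTimes (fun κ => proj Γ (w κ)) T (periodization D) (proj Γ g')).encard =
        (hitTimes (fun κ => proj Γ (w κ)) T (periodization D) (proj Γ g)).encard := by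
  have hregion : ∀ᶠ g' in 𝓝 g, ∀ κ, ∀ γ ∈ Γ,
      (w κ)⁻¹ * γ * g' ∈ hitRegion T (sheet (periodization D) κ) ↔
        (w κ)⁻¹ * γ * g ∈ hitRegion T (sheet (periodization D) κ) :=
    eventually_all.2 fun κ => eventually_forall_mul_mem_iff (isUnitPeriodic_proj_iff.1 (hw κ))
      (stableMatrix_mul_mem_hitRegion_periodization_iff (A := sheet D κ)) isCompact_Icc
      (fun M => apply_one_mem_Icc_of_mem_hitRegion fun q hq => hD _ hq) (hg κ)
  filter_upwards [hregion] with g' hg'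
  have hset : {q : Fin K × Γ | (w q.1)⁻¹ * q.2 * g' ∈ hitRegion T (sheet (periodization D) q.1)} =
      {q | (w q.1)⁻¹ * q.2 * g ∈ hitRegion T (sheet (periodization D) q.1)} := by
    ext q
    exact hg' q.1 q.2 q.2.2
  rw [hitTimes_proj, hitTimes_proj, ← hset]
  refine encard_image_eq_encard_image fun a ha b hb => ?_
  rw [timeCoord_mul_eq_iff ha.1.ne' hb.1.ne',
    timeCoord_mul_eq_iff ((hg' _ _ a.2.2).1 ha).1.ne' ((hg' _ _ b.2.2).1 hb).1.ne']

end LocalConstancy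

section NullBoundaries

-- By Fubini, `f a * g ∈ B` for `ρ.prod ν`-almost no `(a, g)`, so some translate of `B` is null.
lemma measure_eq_zero_of_forall_translates {G α : Type*} [Group G] [MeasurableSpace G]
    [MeasurableMul₂ G] [MeasurableSpace α] {ν : Measure G} [SFinite ν] [ν.IsMulLeftInvariant]
    (ρ : Measure α) [SFinite ρ] [NeZero ρ] {f : α → G} (hf : Measurable f) {B : Set G}
    (hB : MeasurableSet B) (h : ∀ g, ρ {a | f a * g ∈ B} = 0) : ν B = 0 := by
  have hS : MeasurableSet ((fun q : α × G => f q.1 * q.2) ⁻¹' B) :=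
    (hf.comp measurable_fst).mul measurable_snd hB
  have hprod : (ρ.prod ν) ((fun q : α × G => f q.1 * q.2) ⁻¹' B) = 0 := by
    rw [Measure.prod_apply_symm hS]
    exact (lintegral_congr h).trans lintegral_zero
  obtain ⟨a, ha⟩ := ((Measure.measure_prod_null hS).1 hprod).exists
  rw [← measure_preimage_mul ν (f a)]
  exact ha

variable (ν : Measure SL2R) [SFinite ν] [ν.IsMulLeftInvariant]

lemma measure_setOf_row_eq_zero {a b : ℝ} (hab : (a, b) ≠ 0) :
    ν {m | a * m 1 0 + b * m 1 1 = 0} = 0 := by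
  refine measure_eq_zero_of_forall_translates volume continuous_unstableMatrix.measurable ?_ ?_
  · exact (isClosed_eq (((continuous_entry 1 0).const_mul a).add
      ((continuous_entry 1 1).const_mul b)) continuous_const).measurableSet
  · refine fun g => Subsingleton.measure_zero (fun s hs t ht => ?_) _
    have hdet := det_fin_two_eq_one g
    simp only [mem_ofPred_eq, mul_apply_fin_two, unstableMatrix_apply, Matrix.of_apply,
      Matrix.cons_val', Matrix.cons_val_zero, Matrix.cons_val_one, Matrix.cons_val_fin_one]
      at hs ht
    by_contra hst
    have htop : a * g 0 0 + b * g 0 1 = 0 := by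
      refine (mul_eq_zero.1 ?_).resolve_left (sub_ne_zero.2 hst)
      linear_combination ht - hs
    have hbot : a * g 1 0 + b * g 1 1 = 0 := by linear_combination hs + s * htop
    refine hab (Prod.mk_eq_zero.2 ⟨?_, ?_⟩)
    · linear_combination g 1 1 * htop - g 0 1 * hbot - a * hdet
    · linear_combination g 0 0 * hbot - g 1 0 * htop - b * hdet

lemma measurable_sectionCoord : Measurable sectionCoord :=
  ((continuous_entry 0 1).measurable.div (continuous_entry 1 1).measurable).prodMk
    ((continuous_entry 1 1).measurable.log.const_mul (-2))

lemma measurePreserving_shear (a b : ℝ) :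
    MeasurePreserving (fun q : ℝ × ℝ => (Real.exp q.1 * a + q.2, b + q.1)) :=
  (Measure.measurePreserving_swap (μ := (volume : Measure ℝ)) (ν := (volume : Measure ℝ))).comp <|
    (measurePreserving_add_left volume b).skew_product
      (g := fun t s => Real.exp t * a + s) (by fun_prop)
      (Eventually.of_forall fun _ => (measurePreserving_add_left volume _).map_eq)

lemma measure_setOf_sectionCoord_mem_eq_zero {A : Set (ℝ × ℝ)} (hA : volume A = 0) :
    ν {m | 0 < m 1 1 ∧ sectionCoord m ∈ A} = 0 := by
  obtain ⟨A', hAA', hA'meas, hA'⟩ := exists_measurable_superset_of_null hA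
  refine measure_mono_null (t := {m | m 1 1 ≠ 0 ∧ sectionCoord m ∈ A'})
    (fun m hm => ⟨hm.1.ne', hAA' hm.2⟩) ?_
  refine measure_eq_zero_of_forall_translates (volume : Measure (ℝ × ℝ))
    (f := fun q => stableMatrix q.2 * geodesicMatrix q.1) ?_ ?_ fun g => ?_
  · exact ((continuous_stableMatrix.comp continuous_snd).mul
      (continuous_geodesicMatrix.comp continuous_fst)).measurable
  · exact ((continuous_entry 1 1).measurable (measurableSet_singleton 0)).compl.inter
      (measurable_sectionCoord hA'meas)
  · refine measure_mono_null (fun q hq => ?_) ((measurePreserving_shear (sectionCoord g).1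
      (sectionCoord g).2).quasiMeasurePreserving.preimage_null hA')
    rw [mem_ofPred_eq, mul_assoc] at hq
    obtain ⟨h11, hcoord⟩ := hq
    rw [stableMatrix_mul_apply_one] at h11
    rw [sectionCoord_stableMatrix_mul _ h11, sectionCoord_geodesicMatrix_mul] at hcoord
    · exact hcoord
    · exact right_ne_zero_of_mul (geodesicMatrix_mul_apply_one_one q.1 g ▸ h11)

lemma measure_frontier_hitRegion_eq_zero (T : ℝ) {A : Set (ℝ × ℝ)} (hA : volume (frontier A) = 0) :
    ν (frontier (hitRegion T A)) = 0 := by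
  have h11 : ν {m | m 1 1 = 0} = 0 := by
    simpa using measure_setOf_row_eq_zero ν (a := 0) (b := 1) (by simp)
  have h10 : ν {m | m 1 0 = 0} = 0 := by
    simpa using measure_setOf_row_eq_zero ν (a := 1) (b := 0) (by simp)
  have hT : ν {m | m 1 0 = T * m 1 1} = 0 := by
    simpa [← sub_eq_add_neg, sub_eq_zero] using
      measure_setOf_row_eq_zero ν (a := 1) (b := -T) (by simp)
  exact measure_mono_null (frontier_hitRegion_subset T A) <| measure_union_null
    (measure_union_null (measure_union_null h11 h10) hT)
    (measure_setOf_sectionCoord_mem_eq_zero ν hA)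

lemma frontier_periodization_subset {α : Type*} [TopologicalSpace α] (A : Set (ℝ × α)) :
    frontier (periodization A) ⊆ {p | ∃ n : ℤ, p.1 = n} ∪ periodization (frontier A) := by
  refine compl_subset_compl.1 fun p hp => notMem_frontier_iff_eventually.2 ?_
  simp only [mem_compl_iff, mem_union, mem_ofPred_eq, not_or] at hp
  have hfract : ContinuousAt (fun p : ℝ × α => Int.fract p.1) p :=
    ContinuousAt.comp (g := Int.fract) (continuousAt_fract fun h => hp.1 ⟨_, h⟩) continuousAt_fst
  exact (hfract.prodMk continuousAt_snd).eventually (notMem_frontier_iff_eventually.1 hp.2)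

lemma measure_periodization_eq_zero {α : Type*} [MeasurableSpace α] {ρ : Measure α} [SFinite ρ]
    {A : Set (ℝ × α)} (hA : (volume : Measure ℝ).prod ρ A = 0) :
    (volume : Measure ℝ).prod ρ (periodization A) = 0 := by
  refine measure_mono_null (t := ⋃ n : ℤ, Prod.map (fun s : ℝ => s - n) id ⁻¹' A) (fun p hp =>
    mem_iUnion.2 ⟨⌊p.1⌋, by rwa [mem_preimage, Prod.map, Int.self_sub_floor]⟩) ?_
  exact measure_iUnion_null fun n => ((measurePreserving_sub_right volume (n : ℝ)).prod
    (MeasurePreserving.id ρ)).quasiMeasurePreserving.preimage_null hA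

lemma volume_frontier_periodization_eq_zero {A : Set (ℝ × ℝ)} (hA : volume (frontier A) = 0) :
    volume (frontier (periodization A)) = 0 := by
  refine measure_mono_null (frontier_periodization_subset A) (measure_union_null ?_
    (measure_periodization_eq_zero hA))
  have hlines : {p : ℝ × ℝ | ∃ n : ℤ, p.1 = n} = range ((↑) : ℤ → ℝ) ×ˢ univ := by
    ext p
    simp [eq_comm]
  rw [hlines, Measure.volume_eq_prod, Measure.prod_prod,
    (countable_range _).measure_zero, zero_mul]

lemma volume_sheet_eq_zero {K : ℕ} {S : Set (ℝ × ℝ × Fin K)} (hS : sheetVolume K S = 0)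
    (κ : Fin K) : volume (sheet S κ) = 0 := by
  obtain ⟨S', hSS', hS'meas, hS'⟩ := exists_measurable_superset_of_null hS
  refine measure_mono_null (t := sheet S' κ) (fun q hq => hSS' hq) ?_
  have hmeas : MeasurableSet (sheet S' κ) :=
    (by fun_prop : Measurable fun q : ℝ × ℝ => (q.1, q.2, κ)) hS'meas
  rw [Measure.volume_eq_prod, Measure.measure_prod_null hmeas]
  filter_upwards [Measure.measure_ae_null_of_prod_null hS'] with s hs
  rw [Pi.zero_apply, measure_eq_zero_iff_ae_notMem]
  filter_upwards [Measure.measure_ae_null_of_prod_null hs] with t ht hmem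
  exact notMem_empty κ (Measure.count_eq_zero_iff.1 ht ▸ hmem)

lemma volume_frontier_sheet_eq_zero {K : ℕ} {D : Set (ℝ × ℝ × Fin K)}
    (hD : sheetVolume K (frontier D) = 0) (κ : Fin K) : volume (frontier (sheet D κ)) = 0 :=
  have hcont : Continuous fun q : ℝ × ℝ => (q.1, q.2, κ) := by fun_prop
  measure_mono_null (hcont.frontier_preimage_subset D) (volume_sheet_eq_zero hD κ)

end NullBoundaries

section Limit

variable {Γ : Subgroup SL2R} {K : ℕ} {μ lam : Measure (UnitTangent Γ)}

lemma isOpenQuotientMap_proj : IsOpenQuotientMap (proj Γ) :=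
  ⟨proj_surjective, continuous_quotient_mk', isOpenMap_quotient_mk'_mul⟩

lemma Admissible.tendsto_of_measure_frontier_eq_zero (h : Admissible μ lam)
    {E : Set (UnitTangent Γ)} (hE : μ (frontier E) = 0) :
    Tendsto (fun t : ℝ => lam (geodesicFlow t '' E)) atTop (𝓝 (μ E)) := by
  have hint := h _ isOpen_interior.measurableSet (measure_mono_null frontier_interior_subset hE)
  have hcl := h _ isClosed_closure.measurableSet (measure_mono_null frontier_closure_subset hE)
  rw [measure_congr (interior_ae_eq_of_null_frontier hE)] at hint
  rw [measure_congr (closure_ae_eq_of_null_frontier hE)] at hcl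
  exact tendsto_of_tendsto_of_tendsto_of_le_of_le hint hcl
    (fun t => measure_mono (image_mono interior_subset))
    (fun t => measure_mono (image_mono subset_closure))

lemma IsLiouville.measure_frontier_eq_zero (hμ : IsLiouville Γ μ) {E : Set (UnitTangent Γ)}
    (hE : ∀ ν : Measure SL2R, ν.IsHaarMeasure → ∀ᵐ g ∂ν, ∀ᶠ g' in 𝓝 g,
      (proj Γ g' ∈ E ↔ proj Γ g ∈ E)) : μ (frontier E) = 0 := by
  obtain ⟨ν, F, hν, -, -, rfl⟩ := hμ
  have hproj := isOpenQuotientMap_proj (Γ := Γ)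
  rw [Measure.map_apply hproj.continuous.measurable isClosed_frontier.measurableSet,
    hproj.isOpenMap.preimage_frontier_eq_frontier_preimage hproj.continuous]
  refine Measure.absolutelyContinuous_of_le Measure.restrict_le_self ?_
  rw [measure_eq_zero_iff_ae_notMem]
  filter_upwards [hE ν hν] with g hg using notMem_frontier_iff_eventually.2 hg

variable [DiscreteTopology Γ]

lemma measure_frontier_setOf_hitCount_eq_zero (hμ : IsLiouville Γ μ) {x : Fin K → UnitTangent Γ}
    (hx : ∀ κ, IsUnitPeriodic (x κ)) {σ : Fin K → ℝ} {ι : Type*} [Finite ι] (k : ι → ℕ∞)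
    (T : ι → ℝ) {D : ι → Set (ℝ × ℝ × Fin K)} (hDsub : ∀ i, D i ⊆ sectionParam σ)
    (hDbdry : ∀ i, sheetVolume K (frontier (D i)) = 0) :
    μ (frontier {y | ∀ i, hitCount x σ 0 (T i) (D i) y = k i}) = 0 := by
  refine hμ.measure_frontier_eq_zero fun ν _ => ?_
  choose w hw using fun κ => proj_surjective (x κ)
  obtain rfl : (fun κ => proj Γ (w κ)) = x := funext hw
  have : Countable Γ := countable_of_Lindelof_of_discrete
  have hae : ∀ᵐ g ∂ν, ∀ i κ, ∀ γ : Γ,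
      (w κ)⁻¹ * γ * g ∉ frontier (hitRegion (T i) (sheet (periodization (D i)) κ)) := by
    simp only [ae_all_iff]
    intro i κ γ
    refine measure_eq_zero_iff_ae_notMem.1 ((measure_preimage_mul ν ((w κ)⁻¹ * γ) _).trans ?_)
    exact measure_frontier_hitRegion_eq_zero ν (T i)
      (volume_frontier_periodization_eq_zero (volume_frontier_sheet_eq_zero (hDbdry i) κ))
  have hcount (i : ι) (y : UnitTangent Γ) : hitCount (fun κ => proj Γ (w κ)) σ 0 (T i) (D i) y =
      (hitTimes (fun κ => proj Γ (w κ)) (T i) (periodization (D i)) y).encard := by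
    rw [hitTimes_periodization hx (hDsub i)]
    exact hitCount_zero_eq_encard_hitTimes (hDsub i) (fun b => visitTimes_inter_Ioc σ b y ▸
      finite_hitTimes hx (fun _ hp => hp) y) (T i)
  filter_upwards [hae] with g hg
  filter_upwards [eventually_all.2 fun i => eventually_encard_hitTimes_eq hx
    (fun p hp => (hDsub i hp).2) fun κ γ hγ => hg i κ ⟨γ, hγ⟩] with g' hg'
  exact forall_congr' fun i => by rw [hcount, hcount, hg']

end Limit

end HorocycleFlow

theorem mainTheorem7_general {Γ : Subgroup SL2R} [DiscreteTopology Γ]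
    {μ : Measure (UnitTangent Γ)} (hμ : IsLiouville Γ μ)
    {K : ℕ} {x : Fin K → UnitTangent Γ} (hx : ∀ κ, IsUnitPeriodic (x κ))
    {lam : Measure (UnitTangent Γ)} (hlam : Admissible μ lam)
    {σ : Fin K → ℝ} {ι : Type*} [Finite ι] (k : ι → ℕ∞) (T : ι → ℝ)
    {D : ι → Set (ℝ × ℝ × Fin K)} (hDsub : ∀ i, D i ⊆ sectionParam σ)
    (hDbdry : ∀ i, sheetVolume K (frontier (D i)) = 0) :
    Tendsto (fun R : ℝ => lam {x₀ | ∀ i, hitCount x σ R (T i) (D i) x₀ = k i}) atTop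
      (𝓝 (μ {y | ∀ i, hitCount x σ 0 (T i) (D i) y = k i})) := by
  have hnull := measure_frontier_setOf_hitCount_eq_zero hμ hx k T hDsub hDbdry
  refine (hlam.tendsto_of_measure_frontier_eq_zero hnull).congr fun R => ?_
  rw [setOf_hitCount_eq_image_geodesicFlow R]

theorem mainTheorem7 (Γ : Subgroup SL2R) [DiscreteTopology Γ] (hneg : -1 ∈ Γ)
    (μ : Measure (UnitTangent Γ)) (hμ : IsLiouville Γ μ)
    {K : ℕ} (c : Fin K → OnePoint ℝ) (hc : IsCuspSystem Γ c)
    (x : Fin K → UnitTangent Γ) (hx : ∀ κ, OnUnitHorocycle (c κ) (x κ))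
    (lam : Measure (UnitTangent Γ)) [IsProbabilityMeasure lam] (hlam : Admissible μ lam)
    (σ : Fin K → ℝ) (N : ℕ) (k : Fin N → ℕ)
    (T : Fin N → ℝ) (hTpos : ∀ i, 0 < T i) (hTmono : Monotone T)
    (D : Fin N → Set (ℝ × ℝ × Fin K)) (hDsub : ∀ i, D i ⊆ sectionParam σ)
    (hDmeas : ∀ i, MeasurableSet (D i)) (hDbdry : ∀ i, sheetVolume K (frontier (D i)) = 0) :
    Tendsto
      (fun R : ℝ => lam {x₀ | ∀ i, hitCount x σ R (T i) (D i) x₀ = (k i : ℕ∞)}) atTop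
      (𝓝 (μ {y | ∀ i, hitCount x σ 0 (T i) (D i) y = (k i : ℕ∞)})) :=
  mainTheorem7_general hμ (fun κ => (hx κ).2) hlam (fun i => k i) T hDsub hDbdry
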